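/- **Theorem (a Hopf type lemma for anti-symmetric functions).** Let $n\ge 1$, $0<\alpha<2$, $\lambda\in\mathbb R$, let $\Sigma=\{x\in\mathbb R^n : x_1>\lambda\}$, and let $x^\lambda=(2\lambda-x_1,x_2,\dots,x_n)$ be the reflection of $x$ about the plane $\partial\Sigma=\{x_1=\lambda\}$. For a function $u$ on $\mathbb R^n$ let $$(-\Delta)^{\alpha/2}u(x)=C_{n,\alpha}\lim_{\epsilon\to0^+}\int_{\mathbb R^n\setminus B_\epsilon(x)}\frac{u(x)-u(z)}{|x-z|^{n+\alpha}}\,dz,\qquad C_{n,\alpha}=\frac{\alpha\,2^{\alpha-1}\,\Gamma(\frac{n+\alpha}{2})}{\pi^{n/2}\,\Gamma(1-\frac{\alpha}{2})},$$ which is defined at $x$ when these integrals converge absolutely and the limit exists. Let $w:\mathbb R^n\to\mathbb R$ be of class $C^3$ in a neighbourhood of every point of the closed half space $\overline\Sigma$, and let $c$ be a real function such that $$\limsup_{x\to x_0,\;x\in\Sigma}\; c(x)\,\mathrm{dist}(x,\partial\Sigma)^2\le 0\qquad\text{for every }x_0\in\partial\Sigma$$ (in particular, this holds if $c(x)=o(\mathrm{dist}(x,\partial\Sigma)^{-2})$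 near $\partial\Sigma$). Suppose that for every $x\in\Sigma$ the value $(-\Delta)^{\alpha/2}w(x)$ is defined and $$(-\Delta)^{\alpha/2}w(x)+c(x)w(x)=0,\qquad w(x)>0,\qquad w(x^\lambda)=-w(x).$$ Then $\dfrac{\partial w}{\partial\nu}(x)<0$ for every $x\in\partial\Sigma$, where $\nu=(-1,0,\dots,0)$ is the outward unit normal of $\Sigma$. -/

import Mathlib

open Filter Topology MeasureTheory

noncomputable section

/-- The open half space `{x ∈ ℝⁿ : x₁ > lam}`; the first coordinate has index `0`. -/
def halfSpace (n : ℕ) [NeZero n] (lam : ℝ) : Set (EuclideanSpace ℝ (Fin n)) :=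
  {x | lam < x 0}

/-- The reflection `(2 lam - x₁, x₂, …, xₙ)` of `x` about the plane `{x₁ = lam}`. -/
def planeReflection {n : ℕ} [NeZero n] (lam : ℝ) (x : EuclideanSpace ℝ (Fin n)) :
    EuclideanSpace ℝ (Fin n) :=
  WithLp.toLp 2 (Function.update x.ofLp 0 (2 * lam - x 0))

/-- The outward unit normal of the half space `{x₁ > lam}`, the constant vector `-e₁`. -/
def outwardNormal (n : ℕ) [NeZero n] : EuclideanSpace ℝ (Fin n) :=
  -EuclideanSpace.single 0 1

/-- The standard normalization constant `C_{n,α}` of the fractional Laplacian of order `α`,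
`α 2^(α-1) Γ((n+α)/2) / (π^(n/2) Γ(1-α/2))`, which makes its Fourier symbol `|ξ|^α`. -/
def fracLaplacianConst (n : ℕ) (α : ℝ) : ℝ :=
  α * (2 : ℝ) ^ (α - 1) * Real.Gamma ((n + α) / 2) /
    (Real.pi ^ ((n : ℝ) / 2) * Real.Gamma (1 - α / 2))

/-- `(-Δ)^(α/2) u (x)` is defined and equals `L`: the truncated integrals
`∫_{ℝⁿ \ B_ε(x)} (u(x) - u(z)) / |x - z|^(n+α) dz` converge absolutely, and `C_{n,α}` times
these integrals tends to `L` as `ε → 0⁺`. -/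
def HasFracLaplacianAt {n : ℕ} (α : ℝ) (u : EuclideanSpace ℝ (Fin n) → ℝ)
    (x : EuclideanSpace ℝ (Fin n)) (L : ℝ) : Prop :=
  (∀ ε : ℝ, 0 < ε →
    IntegrableOn (fun z => (u x - u z) / ‖x - z‖ ^ ((n : ℝ) + α)) (Metric.ball x ε)ᶜ volume) ∧
  Tendsto
    (fun ε : ℝ => fracLaplacianConst n α *
      ∫ z in (Metric.ball x ε)ᶜ, (u x - u z) / ‖x - z‖ ^ ((n : ℝ) + α))
    (𝓝[>] 0) (𝓝 L)

end

/-! Move the boundary point to the origin, let `u y = w (x + y)`, let `e` be the inner normal and `p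
= n + α`. Positivity gives `∂ₑu(0) ≥ 0`; suppose it vanishes, and read the equation at `t e` as `t →
0⁺`. Oddness and `C³` regularity force `u (t e) = O(t³)`, so the zero-order term is at most `o(t)`.
The contradiction is that the principal value is at most a negative multiple of `t`.

For this, split `‖y‖ ^ (-p)` into `truncKernel p r` and a singular remainder that vanishes for `‖y‖
≥ r`. Against the truncated kernel, folding along the reflection leaves `u` times a kernel
difference of the same sign as `u`; the mass of `u` near `2e` alone yields a gain `k t` with `k > 0`
independent of `r` (`integral_sub_mul_truncKernel_le`). Against the remainder, averaging over `y,
-y, R y, -R y` produces the difference of the second differences of `u` at `t e` and `-t e`, which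
is `O(t ‖y‖²)` (`integral_sub_mul_le_of_secondDiff`). Its integral is `t` times a quantity tending
to `0` with `r`, because `p < n + 2`. Fixing `r` small and then `t` small, the gain wins. -/

/-! ### Local bounds from second differences. -/

/-- Second symmetric differences of a `C²` function are locally quadratically bounded. -/
theorem exists_abs_secondDiff_le_of_contDiffAt {E : Type*} [NormedAddCommGroup E] [NormedSpace ℝ E]
    {v : E → ℝ} {a : E} (hv : ContDiffAt ℝ 2 v a) :
    ∃ ρ M : ℝ, 0 < ρ ∧ 0 ≤ M ∧ ∀ p y : E, dist p a < ρ → ‖y‖ < ρ →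
      |v (p + y) + v (p - y) - 2 * v p| ≤ M * ‖y‖ ^ 2 := by
  have hd : ContDiffAt ℝ 1 (fderiv ℝ v) a := hv.fderiv_right (m := 1) (by norm_num)
  obtain ⟨K, s, hs, hK⟩ := hd.exists_lipschitzOnWith
  have hdiff : ∀ᶠ x in 𝓝 a, DifferentiableAt ℝ v x :=
    (hv.eventually (by simp)).mono fun x hx => hx.differentiableAt (by simp)
  obtain ⟨δ, hδ, hball⟩ := Metric.mem_nhds_iff.1 (inter_mem hs hdiff)
  refine ⟨δ / 2, 2 * K, by positivity, by positivity, fun p y hp hy => ?_⟩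
  have mem : ∀ s : ℝ, s ∈ Set.Icc (-1 : ℝ) 1 → p + s • y ∈ Metric.ball a δ := by
    intro s hs
    have h1 : ‖s • y‖ ≤ ‖y‖ := by
      rw [norm_smul]
      exact mul_le_of_le_one_left (norm_nonneg _) (abs_le.2 hs)
    rw [dist_eq_norm] at hp
    rw [Metric.mem_ball, dist_eq_norm]
    calc ‖p + s • y - a‖ = ‖(p - a) + s • y‖ := by congr 1; abel
      _ ≤ ‖p - a‖ + ‖s • y‖ := norm_add_le _ _
      _ < δ := by linarith
  -- The `s`-derivative compares `fderiv ℝ v` at two points at distance at most `2 ‖y‖`, where it is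
  -- Lipschitz.
  have key : ∀ s ∈ Set.Icc (0 : ℝ) 1, HasDerivWithinAt
      (fun s : ℝ => v (p + s • y) + v (p + (-s) • y))
      (fderiv ℝ v (p + s • y) y - fderiv ℝ v (p + (-s) • y) y) (Set.Icc 0 1) s := by
    intro s hs
    have h1 := (hball (mem s ⟨by linarith [hs.1], hs.2⟩)).2
    have h2 := (hball (mem (-s) ⟨by linarith [hs.2], by linarith [hs.1]⟩)).2
    have c1 : HasDerivAt (fun s : ℝ => p + s • y) y s := by
      simpa using ((hasDerivAt_id s).smul_const y).const_add p
    have c2 : HasDerivAt (fun s : ℝ => p + (-s) • y) (-y) s := by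
      simpa using ((hasDerivAt_id s).neg.smul_const y).const_add p
    have d1 := h1.hasFDerivAt.comp_hasDerivAt s c1
    have d2 := h2.hasFDerivAt.comp_hasDerivAt s c2
    exact ((d1.add d2).congr_deriv (by simp [sub_eq_add_neg])).hasDerivWithinAt
  have bound : ∀ s ∈ Set.Icc (0 : ℝ) 1,
      ‖fderiv ℝ v (p + s • y) y - fderiv ℝ v (p + (-s) • y) y‖ ≤ 2 * K * ‖y‖ ^ 2 := by
    intro s hs
    have h1 := (hball (mem s ⟨by linarith [hs.1], hs.2⟩)).1
    have h2 := (hball (mem (-s) ⟨by linarith [hs.2], by linarith [hs.1]⟩)).1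
    have h3 := hK.dist_le_mul _ h1 _ h2
    have h4 : dist (p + s • y) (p + (-s) • y) ≤ 2 * ‖y‖ := by
      rw [dist_eq_norm, show p + s • y - (p + (-s) • y) = (2 * s) • y by module, norm_smul]
      gcongr
      rw [Real.norm_eq_abs, abs_le]
      constructor <;> linarith [hs.1, hs.2]
    rw [← sub_apply]
    calc _ ≤ ‖fderiv ℝ v (p + s • y) - fderiv ℝ v (p + (-s) • y)‖ * ‖y‖ :=
          ContinuousLinearMap.le_opNorm _ _
      _ ≤ (K * (2 * ‖y‖)) * ‖y‖ := by
          gcongr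
          rw [← dist_eq_norm]
          exact h3.trans (by gcongr)
      _ = _ := by ring
  have := (convex_Icc (0 : ℝ) 1).norm_image_sub_le_of_norm_hasDerivWithin_le key bound
    (Set.left_mem_Icc.2 zero_le_one) (Set.right_mem_Icc.2 zero_le_one)
  simp only [one_smul, neg_smul, zero_smul, neg_zero, add_zero, sub_zero, norm_one, mul_one,
    Real.norm_eq_abs] at this
  rwa [← sub_eq_add_neg, ← two_mul] at this

section Antisymmetric

variable {E : Type*} [NormedAddCommGroup E] [InnerProductSpace ℝ E]

/-- A `C³` function which is odd across the hyperplane `e^⊥` and whose derivative in the direction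
`e` vanishes at the origin is cubically small along `e`, and its second differences at `t e` and
`-t e` nearly agree. -/
theorem exists_bounds_of_odd_of_fderiv_eq_zero {u : E → ℝ} {e : E} (he : ‖e‖ = 1)
    (hu : ContDiffAt ℝ 3 u 0) (hodd : ∀ t : ℝ, u (-(t • e)) = -u (t • e))
    (hd : fderiv ℝ u 0 e = 0) :
    ∃ ρ M : ℝ, 0 < ρ ∧ 0 ≤ M ∧ (∀ y, ‖y‖ < ρ → ContinuousAt u y) ∧
      (∀ t, 0 ≤ t → t < ρ → 2 * u (t • e) ≤ M * t ^ 3) ∧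
      ∀ t y, 0 ≤ t → t < ρ → ‖y‖ < ρ →
        (2 * u (t • e) - u (t • e + y) - u (t • e - y)) -
          (2 * u (-(t • e)) - u (-(t • e) + y) - u (-(t • e) - y)) ≤ 2 * t * M * ‖y‖ ^ 2 := by
  have hv : ContDiffAt ℝ 2 (fun x => fderiv ℝ u x e) 0 :=
    (hu.fderiv_right (m := 2) (by norm_num)).clm_apply contDiffAt_const
  obtain ⟨δ, M, hδ, hM, hb⟩ := exists_abs_secondDiff_le_of_contDiffAt hv
  have hdiff : ∀ᶠ x in 𝓝 (0 : E), DifferentiableAt ℝ u x :=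
    (hu.eventually (by simp)).mono fun x hx => hx.differentiableAt (by simp)
  obtain ⟨η, hη, hball⟩ := Metric.mem_nhds_iff.1 hdiff
  have hdf : ∀ x, ‖x‖ < η → DifferentiableAt ℝ u x := fun x hx => hball (by simpa using hx)
  have hline : ∀ s : ℝ, ‖s • e‖ = |s| := fun s => by rw [norm_smul, he, mul_one, Real.norm_eq_abs]
  have hcurve : ∀ (a : E) (s : ℝ), HasDerivAt (fun s : ℝ => s • e + a) e s := fun a s => by
    simpa using ((hasDerivAt_id s).smul_const e).add_const a
  -- Half of `η` keeps `s • e ± y` in the ball where `u` is differentiable.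
  refine ⟨min δ (η / 2), M, by positivity, hM,
    fun y hy => (hdf y ?_).continuousAt, fun t h0 ht => ?_, fun t y h0 ht hy => ?_⟩
  · have := hy.trans_le (min_le_right _ _); linarith
  · have ht1 := ht.trans_le (min_le_left _ _)
    have ht2 := ht.trans_le (min_le_right _ _)
    -- As `fderiv ℝ u 0 e = 0`, this derivative is a second difference of `fderiv ℝ u · e` at `0`,
    -- hence `O(t²)`.
    have key : ∀ s ∈ Set.Icc (0 : ℝ) t, HasDerivWithinAt (fun s : ℝ => u (s • e) - u ((-s) • e))
        (fderiv ℝ u (s • e) e + fderiv ℝ u ((-s) • e) e) (Set.Icc 0 t) s := by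
      intro s hs
      have h1 : DifferentiableAt ℝ u (s • e) :=
        hdf _ (by rw [hline, abs_of_nonneg hs.1]; linarith [hs.2])
      have h2 : DifferentiableAt ℝ u ((-s) • e) :=
        hdf _ (by rw [hline, abs_neg, abs_of_nonneg hs.1]; linarith [hs.2])
      have c1 : HasDerivAt (fun s : ℝ => s • e) e s := by
        simpa using (hasDerivAt_id s).smul_const e
      have c2 : HasDerivAt (fun s : ℝ => (-s) • e) (-e) s := by
        simpa using (hasDerivAt_id s).neg.smul_const e
      have d1 := h1.hasFDerivAt.comp_hasDerivAt s c1
      have d2 := h2.hasFDerivAt.comp_hasDerivAt s c2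
      exact ((d1.sub d2).congr_deriv (by simp)).hasDerivWithinAt
    have bound : ∀ s ∈ Set.Icc (0 : ℝ) t,
        ‖fderiv ℝ u (s • e) e + fderiv ℝ u ((-s) • e) e‖ ≤ M * t ^ 2 := by
      intro s hs
      have h1 := hb 0 (s • e) (by simpa using hδ) (by rw [hline, abs_of_nonneg hs.1]; linarith [hs.2])
      rw [hline, sq_abs] at h1
      simp only [zero_add, zero_sub, hd, mul_zero, sub_zero] at h1
      rw [neg_smul]
      refine h1.trans ?_
      have := hs.1
      have := hs.2
      gcongr
    have := (convex_Icc (0 : ℝ) t).norm_image_sub_le_of_norm_hasDerivWithin_le key bound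
      (Set.left_mem_Icc.2 h0) (Set.right_mem_Icc.2 h0)
    simp only [neg_smul, hodd, zero_smul, neg_zero, sub_self, sub_zero, Real.norm_eq_abs,
      abs_of_nonneg h0] at this
    have := (le_abs_self _).trans this
    linarith
  · have ht1 := ht.trans_le (min_le_left _ _)
    have ht2 := ht.trans_le (min_le_right _ _)
    have hy1 := hy.trans_le (min_le_left _ _)
    have hy2 := hy.trans_le (min_le_right _ _)
    have habs : ∀ s ∈ Set.Icc (-t) t, ‖s • e‖ ≤ t := fun s hs => by
      rw [hline]; exact abs_le.2 hs
    -- Moving the centre along `e` turns the second difference of `u` into that of `fderiv ℝ u · e`;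
    -- the interval has length `2 t`.
    have key : ∀ s ∈ Set.Icc (-t) t, HasDerivWithinAt
        (fun s : ℝ => 2 * u (s • e + 0) - u (s • e + y) - u (s • e + -y))
        (2 * fderiv ℝ u (s • e + 0) e - fderiv ℝ u (s • e + y) e - fderiv ℝ u (s • e + -y) e)
        (Set.Icc (-t) t) s := by
      intro s hs
      have h := habs s hs
      have d : ∀ a : E, ‖a‖ < η / 2 →
          HasDerivAt (fun s : ℝ => u (s • e + a)) (fderiv ℝ u (s • e + a) e) s := fun a ha =>
        (hdf _ ((norm_add_le _ _).trans_lt (by linarith))).hasFDerivAt.comp_hasDerivAt s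
          (hcurve a s)
      exact ((((d 0 (by simpa using hη)).const_mul 2).sub (d y hy2)).sub
        (d (-y) (by simpa using hy2))).hasDerivWithinAt
    have bound : ∀ s ∈ Set.Icc (-t) t,
        ‖2 * fderiv ℝ u (s • e + 0) e - fderiv ℝ u (s • e + y) e - fderiv ℝ u (s • e + -y) e‖
          ≤ M * ‖y‖ ^ 2 := by
      intro s hs
      have h1 := hb (s • e) y (by simpa using (habs s hs).trans_lt ht1) hy1
      rw [← norm_neg]
      convert h1 using 1
      rw [Real.norm_eq_abs, add_zero, ← sub_eq_add_neg]
      congr 1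
      ring
    have := (convex_Icc (-t) t).norm_image_sub_le_of_norm_hasDerivWithin_le key bound
      (Set.left_mem_Icc.2 (by linarith)) (Set.right_mem_Icc.2 (by linarith))
    have h3 := (le_abs_self _).trans this
    rw [Real.norm_eq_abs, abs_of_nonneg (by linarith)] at h3
    simp only [neg_smul, add_zero, ← sub_eq_add_neg] at h3
    linarith

end Antisymmetric

/-! ### The truncated kernel. -/

/-- The kernel `‖y‖ ^ (-p)`, truncated to a constant on the ball of radius `r`. -/
noncomputable def truncKernel {E : Type*} [NormedAddCommGroup E] (p r : ℝ) (y : E) : ℝ :=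
  max ‖y‖ r ^ (-p)

section TruncKernel

variable {E : Type*} [NormedAddCommGroup E] {p r : ℝ}

theorem truncKernel_nonneg (hr : 0 < r) (y : E) : 0 ≤ truncKernel p r y :=
  Real.rpow_nonneg (hr.le.trans (le_max_right _ _)) _

theorem truncKernel_of_le {y : E} (hy : r ≤ ‖y‖) : truncKernel p r y = ‖y‖ ^ (-p) := by
  rw [truncKernel, max_eq_left hy]

theorem truncKernel_anti (hp : 0 ≤ p) (hr : 0 < r) {y z : E} (h : ‖y‖ ≤ ‖z‖) :
    truncKernel p r z ≤ truncKernel p r y :=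
  Real.rpow_le_rpow_of_nonpos (hr.trans_le (le_max_right _ _)) (max_le_max_right _ h)
    (neg_nonpos.2 hp)

theorem truncKernel_le (hp : 0 ≤ p) {y : E} (hy : 0 < ‖y‖) : truncKernel p r y ≤ ‖y‖ ^ (-p) :=
  Real.rpow_le_rpow_of_nonpos hy (le_max_left _ _) (neg_nonpos.2 hp)

theorem continuous_truncKernel (hr : 0 < r) : Continuous (truncKernel p r : E → ℝ) :=
  (continuous_norm.max continuous_const).rpow_const fun _ =>
    Or.inl (hr.trans_le (le_max_right _ _)).ne'

theorem integrable_truncKernel [InnerProductSpace ℝ E] [FiniteDimensional ℝ E] [MeasurableSpace E]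
    [BorelSpace E] (hp0 : 0 ≤ p) (hp : (Module.finrank ℝ E : ℝ) < p) (hr : 0 < r) :
    Integrable (truncKernel p r : E → ℝ) := by
  refine ((integrable_one_add_norm (μ := volume) hp).mul_const ((1 + r⁻¹) ^ p)).mono'
    (continuous_truncKernel hr).aestronglyMeasurable (ae_of_all _ fun y => ?_)
  rw [Real.norm_of_nonneg (truncKernel_nonneg hr y), truncKernel]
  have h1 : (0 : ℝ) < 1 + r⁻¹ := by positivity
  have h2 : (1 + ‖y‖) / (1 + r⁻¹) ≤ max ‖y‖ r := by
    rw [div_le_iff₀ h1]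
    have h3 := le_max_left ‖y‖ r
    have h4 : 1 ≤ max ‖y‖ r * r⁻¹ := by
      rw [← div_eq_mul_inv, one_le_div hr]
      exact le_max_right _ _
    linarith
  calc max ‖y‖ r ^ (-p) ≤ ((1 + ‖y‖) / (1 + r⁻¹)) ^ (-p) :=
        Real.rpow_le_rpow_of_nonpos (by positivity) h2 (neg_nonpos.2 hp0)
    _ = _ := by
        rw [Real.div_rpow (by positivity) h1.le, Real.rpow_neg h1.le, div_inv_eq_mul]

end TruncKernel

/-- A quantitative lower bound for the decrease of `s ↦ s ^ (-p)`. -/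
theorem mul_sq_sub_sq_le_rpow_neg_sub_rpow_neg {a b p : ℝ} (hp : 1 ≤ p) (ha : 0 < a)
    (hab : a ≤ b) (hb : b ≤ 4) :
    4 ^ (-p) * ((b ^ 2 - a ^ 2) / 32) ≤ a ^ (-p) - b ^ (-p) := by
  have hb0 : 0 < b := ha.trans_le hab
  have h1 : b / a ≤ (b / a) ^ p := by
    simpa using Real.rpow_le_rpow_of_exponent_le ((one_le_div ha).2 hab) hp
  have h2 : a ^ (-p) = b ^ (-p) * (b / a) ^ p := by
    rw [Real.div_rpow hb0.le ha.le, Real.rpow_neg ha.le, Real.rpow_neg hb0.le]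
    have := (Real.rpow_pos_of_pos hb0 p).ne'
    field_simp
  have h3 : (4 : ℝ) ^ (-p) ≤ b ^ (-p) := Real.rpow_le_rpow_of_nonpos hb0 hb (by linarith)
  have h4 : (b ^ 2 - a ^ 2) / 32 ≤ b / a - 1 := by
    rw [div_sub_one ha.ne', div_le_div_iff₀ (by norm_num) ha]
    have : (b + a) * a ≤ 32 := by nlinarith
    nlinarith [mul_nonneg (sub_nonneg.2 hab) (sub_nonneg.2 this)]
  have h5 : 0 ≤ (b ^ 2 - a ^ 2) / 32 := by
    have : 0 ≤ b ^ 2 - a ^ 2 := by nlinarith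
    positivity
  calc 4 ^ (-p) * ((b ^ 2 - a ^ 2) / 32) ≤ b ^ (-p) * ((b / a) ^ p - 1) :=
        mul_le_mul h3 (by linarith) h5 (Real.rpow_nonneg hb0.le _)
    _ = _ := by rw [h2]; ring

/-! ### Symmetrization by the reflection. -/

section Reflection

variable {E : Type*} [NormedAddCommGroup E] [InnerProductSpace ℝ E] {e : E} {R : E ≃ₗᵢ[ℝ] E}
  {u : E → ℝ}

local notation "⟪" x ", " y "⟫" => inner ℝ x y

theorem reflection_smul_self (he : ‖e‖ = 1) (hR : ∀ y, R y = y - (2 * ⟪e, y⟫) • e) (t : ℝ) :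
    R (t • e) = -(t • e) := by
  rw [hR, inner_smul_right, real_inner_self_eq_norm_sq, he]
  module

theorem inner_reflection (he : ‖e‖ = 1) (hR : ∀ y, R y = y - (2 * ⟪e, y⟫) • e) (y : E) :
    ⟪e, R y⟫ = -⟪e, y⟫ := by
  rw [hR, inner_sub_right, inner_smul_right, real_inner_self_eq_norm_sq, he]
  ring

theorem mul_inner_nonneg_of_odd (he : ‖e‖ = 1) (hR : ∀ y, R y = y - (2 * ⟪e, y⟫) • e)
    (hodd : ∀ y, u (R y) = -u y) (hpos : ∀ y, 0 < ⟪e, y⟫ → 0 < u y) (y : E) :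
    (0 ≤ ⟪e, y⟫ ∧ 0 ≤ u y) ∨ (⟪e, y⟫ ≤ 0 ∧ u y ≤ 0) := by
  rcases lt_trichotomy ⟪e, y⟫ 0 with h | h | h
  · have := hpos (R y) (by rw [inner_reflection he hR]; linarith)
    rw [hodd] at this
    exact Or.inr ⟨h.le, by linarith⟩
  · have h1 : R y = y := by rw [hR, h]; simp
    have h2 := hodd y
    rw [h1] at h2
    exact Or.inl ⟨h.ge, by linarith⟩
  · exact Or.inl ⟨h.le, (hpos y h).le⟩

/-- Decides which of `t e` and `-t e` is nearer to `z`, and by how much. -/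
theorem norm_add_smul_sq_sub (e : E) (t : ℝ) (z : E) :
    ‖z + t • e‖ ^ 2 - ‖z - t • e‖ ^ 2 = 4 * t * ⟪e, z⟫ := by
  rw [norm_add_sq_real, norm_sub_sq_real, inner_smul_right, real_inner_comm]
  ring

variable [FiniteDimensional ℝ E] [MeasurableSpace E] [BorelSpace E]

/-- Fourfold symmetrization of an integral against an even, reflection invariant kernel. -/
theorem integral_sub_mul_le_of_secondDiff (he : ‖e‖ = 1)
    (hR : ∀ y, R y = y - (2 * ⟪e, y⟫) • e) (hodd : ∀ y, u (R y) = -u y) {κ b : E → ℝ} {t : ℝ}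
    (hneg : ∀ y, κ (-y) = κ y) (hκR : ∀ y, κ (R y) = κ y)
    (hint : Integrable fun y => (u (t • e) - u (t • e + y)) * κ y) (hb : Integrable b)
    (hle : ∀ y, ((2 * u (t • e) - u (t • e + y) - u (t • e - y)) -
      (2 * u (-(t • e)) - u (-(t • e) + y) - u (-(t • e) - y))) * κ y ≤ b y) :
    4 * ∫ y, (u (t • e) - u (t • e + y)) * κ y ≤ ∫ y, b y := by
  set F : E → ℝ := fun y => (u (t • e) - u (t • e + y)) * κ y with hF
  have hmp : MeasurePreserving R (volume : Measure E) volume := R.measurePreserving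
  have hme : MeasurableEmbedding R := R.toHomeomorph.measurableEmbedding
  have i2 : Integrable fun y => F (-y) := hint.comp_neg
  have i3 : Integrable fun y => F (R y) := (hmp.integrable_comp_emb hme).2 hint
  have i4 : Integrable fun y => F (-R y) := (hmp.integrable_comp_emb hme (g := fun y => F (-y))).2 i2
  have e2 : ∫ y, F (-y) = ∫ y, F y := integral_neg_eq_self F volume
  have e3 : ∫ y, F (R y) = ∫ y, F y := hmp.integral_comp hme F
  have e4 : ∫ y, F (-R y) = ∫ y, F y := (hmp.integral_comp hme fun y => F (-y)).trans e2
  have hs : 4 * ∫ y, F y = ∫ y, ((F y + F (-y)) + (F (R y) + F (-R y))) := by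
    have h1 := integral_add hint i2
    have h2 := integral_add i3 i4
    have h3 : ∫ y, ((F y + F (-y)) + (F (R y) + F (-R y))) = _ :=
      integral_add (hint.add i2) (i3.add i4)
    rw [h3, h1, h2, e2, e3, e4]
    ring
  rw [hs]
  refine integral_mono ((hint.add i2).add (i3.add i4)) hb fun y => le_trans (le_of_eq ?_) (hle y)
  -- Oddness converts values around `t e` at reflected increments into values around `-t e`.
  have h1 : u (t • e + R y) = -u (-(t • e) + y) := by
    rw [← hodd, map_add, map_neg, reflection_smul_self he hR, neg_neg]
  have h2 : u (t • e + -R y) = -u (-(t • e) - y) := by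
    rw [← hodd, map_sub, map_neg, reflection_smul_self he hR, neg_neg, sub_eq_add_neg]
  have h3 : u (-(t • e)) = -u (t • e) := by rw [← hodd, reflection_smul_self he hR]
  simp only [hF, hneg, hκR, h1, h2, h3]
  rw [← sub_eq_add_neg]
  ring

/-- The truncated kernel sees the positivity of `u` on the half space to first order in the
distance `t` to the hyperplane. -/
theorem integral_sub_mul_truncKernel_le (he : ‖e‖ = 1)
    (hR : ∀ y, R y = y - (2 * ⟪e, y⟫) • e) (hodd : ∀ y, u (R y) = -u y)
    (hpos : ∀ y, 0 < ⟪e, y⟫ → 0 < u y) {p r t : ℝ} (hp1 : 1 ≤ p)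
    (hp : (Module.finrank ℝ E : ℝ) < p) (hr : 0 < r) (hr2 : r ≤ 1 / 2) (ht : 0 ≤ t)
    (ht2 : t ≤ 1 / 2) (hu : IntegrableOn u (Metric.ball ((2 : ℝ) • e) 1))
    (hint : Integrable fun y => (u (t • e) - u (t • e + y)) * truncKernel p r y) :
    ∫ y, (u (t • e) - u (t • e + y)) * truncKernel p r y ≤
      u (t • e) * (∫ y : E, truncKernel p r y) -
        t * (4 ^ (-p) / 16 * ∫ z in Metric.ball ((2 : ℝ) • e) 1, u z) := by
  have hp0 : 0 ≤ p := by linarith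
  have hk := integrable_truncKernel (E := E) hp0 hp hr
  have hmp : MeasurePreserving R (volume : Measure E) volume := R.measurePreserving
  have hme : MeasurableEmbedding R := R.toHomeomorph.measurableEmbedding
  have hi1 : Integrable fun y => u (t • e + y) * truncKernel p r y := by
    refine ((hk.const_mul (u (t • e))).sub hint).congr (ae_of_all _ fun y => ?_)
    simp only [Pi.sub_apply]
    ring
  set G : E → ℝ := fun z => u z * truncKernel p r (z - t • e) with hG
  have hi2 : Integrable G := by
    refine (hi1.comp_sub_right (t • e)).congr (ae_of_all _ fun z => ?_)
    simp [hG]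
  have hGint : ∫ y, u (t • e + y) * truncKernel p r y = ∫ z, G z := by
    rw [← integral_sub_right_eq_self _ (t • e)]
    simp [hG]
  have hGR : ∀ z, G (R z) = -(u z * truncKernel p r (z + t • e)) := fun z => by
    have : ‖R z - t • e‖ = ‖z + t • e‖ := by
      rw [← R.norm_map (z + t • e), map_add, reflection_smul_self he hR, ← sub_eq_add_neg]
    simp only [hG, truncKernel, this, hodd]
    ring
  have hi3 : Integrable fun z => G (R z) := (hmp.integrable_comp_emb hme).2 hi2
  have hfold : 2 * ∫ z, G z =
      ∫ z, u z * (truncKernel p r (z - t • e) - truncKernel p r (z + t • e)) := by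
    have e3 : ∫ z, G (R z) = ∫ z, G z := hmp.integral_comp hme G
    rw [two_mul]
    nth_rewrite 2 [← e3]
    rw [← integral_add hi2 hi3]
    refine integral_congr_ae (ae_of_all _ fun z => ?_)
    simp only [hGR]
    simp only [hG]
    ring
  have hi4 : Integrable fun z =>
      u z * (truncKernel p r (z - t • e) - truncKernel p r (z + t • e)) := by
    refine (hi2.add hi3).congr (ae_of_all _ fun z => ?_)
    simp only [Pi.add_apply, hGR]
    simp only [hG]
    ring
  have hnn : ∀ z, 0 ≤ u z * (truncKernel p r (z - t • e) - truncKernel p r (z + t • e)) := by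
    intro z
    have hn := norm_add_smul_sq_sub e t z
    rcases mul_inner_nonneg_of_odd he hR hodd hpos z with ⟨h1, h2⟩ | ⟨h1, h2⟩
    · refine mul_nonneg h2 (sub_nonneg.2 (truncKernel_anti hp0 hr ?_))
      refine le_of_sq_le_sq ?_ (norm_nonneg _)
      nlinarith [mul_nonneg ht h1]
    · refine mul_nonneg_of_nonpos_of_nonpos h2 (sub_nonpos.2 (truncKernel_anti hp0 hr ?_))
      refine le_of_sq_le_sq ?_ (norm_nonneg _)
      nlinarith [mul_nonneg ht (neg_nonneg.2 h1)]
  -- On this ball both distances lie in `[1/2, 4]`, so the truncation is inactive. Their squares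
  -- differ by `4 t ⟪e, z⟫ ≥ 4 t`; dividing by `32` gives `t / 8`, and the factor `2` in `hfold`
  -- turns `8` into `16`.
  have hlow : ∫ z in Metric.ball ((2 : ℝ) • e) 1, u z * (4 ^ (-p) * (t / 8)) ≤
      ∫ z, u z * (truncKernel p r (z - t • e) - truncKernel p r (z + t • e)) := by
    refine le_trans (setIntegral_mono_on (hu.mul_const _) hi4.integrableOn
      Metric.isOpen_ball.measurableSet fun z hz => ?_)
      (setIntegral_le_integral hi4 (ae_of_all _ hnn))
    rw [Metric.mem_ball, dist_eq_norm] at hz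
    have h2e : ‖(2 : ℝ) • e‖ = 2 := by rw [norm_smul, he]; norm_num
    have hte : ‖t • e‖ = t := by rw [norm_smul, he, mul_one, Real.norm_of_nonneg ht]
    have hζ : 1 ≤ ⟪e, z⟫ := by
      have h1 : |⟪e, z - (2 : ℝ) • e⟫| ≤ 1 * 1 :=
        (abs_real_inner_le_norm _ _).trans (by rw [he]; gcongr)
      rw [inner_sub_right, inner_smul_right, real_inner_self_eq_norm_sq, he] at h1
      linarith [(abs_le.1 h1).1]
    have hz3 : ‖z‖ ≤ 3 := by
      have := norm_add_le (z - (2 : ℝ) • e) ((2 : ℝ) • e)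
      rw [sub_add_cancel] at this
      linarith
    have hz1 : 1 ≤ ‖z‖ := by
      have := abs_real_inner_le_norm e z
      rw [he, one_mul] at this
      linarith [le_abs_self ⟪e, z⟫]
    have hn := norm_add_smul_sq_sub e t z
    have ha : 1 / 2 ≤ ‖z - t • e‖ := by
      have := norm_sub_norm_le z (t • e)
      linarith
    have hab : ‖z - t • e‖ ≤ ‖z + t • e‖ := by
      refine le_of_sq_le_sq ?_ (norm_nonneg _)
      nlinarith [mul_nonneg ht (zero_le_one.trans hζ)]
    have hb : ‖z + t • e‖ ≤ 4 := by
      have := norm_add_le z (t • e)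
      linarith
    rw [truncKernel_of_le (hr2.trans ha), truncKernel_of_le (hr2.trans (ha.trans hab))]
    refine mul_le_mul_of_nonneg_left ?_ (hpos z (by linarith)).le
    refine le_trans ?_ (mul_sq_sub_sq_le_rpow_neg_sub_rpow_neg hp1 (by linarith) hab hb)
    rw [hn]
    refine mul_le_mul_of_nonneg_left ?_ (Real.rpow_nonneg (by norm_num) _)
    nlinarith [mul_nonneg ht (sub_nonneg.2 hζ)]
  have hsplit : ∫ y, (u (t • e) - u (t • e + y)) * truncKernel p r y =
      u (t • e) * (∫ y : E, truncKernel p r y) - ∫ z, G z := by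
    rw [← hGint, ← integral_const_mul, ← integral_sub (hk.const_mul _) hi1]
    simp only [sub_mul]
  rw [integral_mul_const] at hlow
  rw [hsplit]
  linarith

end Reflection

/-! ### The principal value at points near the hyperplane. -/

section Reflection

variable {E : Type*} [NormedAddCommGroup E] [InnerProductSpace ℝ E] {e : E} {R : E ≃ₗᵢ[ℝ] E}
  {u : E → ℝ}

local notation "⟪" x ", " y "⟫" => inner ℝ x y

variable [FiniteDimensional ℝ E] [MeasurableSpace E] [BorelSpace E]

theorem tendsto_volume_ball_zero (hdim : 1 ≤ Module.finrank ℝ E) :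
    Tendsto (volume ∘ fun ε : ℝ => Metric.ball (0 : E) ε) (𝓝[>] 0) (𝓝 0) := by
  have h1 : ∀ᶠ ε : ℝ in 𝓝[>] 0, ENNReal.ofReal ε ^ Module.finrank ℝ E *
      volume (Metric.ball (0 : E) 1) = (volume ∘ fun ε => Metric.ball (0 : E) ε) ε :=
    eventually_mem_nhdsWithin.mono fun ε hε => by
      rw [Function.comp, Measure.addHaar_ball_of_pos _ _ hε, ENNReal.ofReal_pow (le_of_lt hε)]
  refine Tendsto.congr' h1 ?_
  have h2 : Tendsto (fun ε : ℝ => ENNReal.ofReal ε ^ Module.finrank ℝ E) (𝓝[>] 0) (𝓝 0) := by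
    have : Tendsto (fun ε : ℝ => ENNReal.ofReal ε) (𝓝[>] 0) (𝓝 (ENNReal.ofReal 0)) :=
      (ENNReal.continuous_ofReal.tendsto 0).mono_left nhdsWithin_le_nhds
    have h3 := ((ENNReal.continuous_pow (Module.finrank ℝ E)).tendsto _).comp this
    rwa [ENNReal.ofReal_zero, zero_pow (Nat.one_le_iff_ne_zero.1 hdim)] at h3
  simpa using ENNReal.Tendsto.mul_const h2 (Or.inr Metric.isBounded_ball.measure_lt_top.ne)

theorem integrableOn_ball_norm_rpow {p : ℝ} (hdim : 1 ≤ Module.finrank ℝ E)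
    (hp : p < Module.finrank ℝ E + 2) (r : ℝ) :
    IntegrableOn (fun y : E => ‖y‖ ^ (2 - p)) (Metric.ball 0 r) := by
  refine integrableOn_ball_of_norm_le_rpow hdim (C := 1) (α := p - 2) (by linarith)
    (ae_of_all _ fun y => ?_) (measurable_norm.pow_const _).aestronglyMeasurable
  rw [Real.norm_of_nonneg (Real.rpow_nonneg (norm_nonneg _) _), one_mul, neg_sub]

theorem tendsto_integral_ball_norm_rpow {p : ℝ} (hdim : 1 ≤ Module.finrank ℝ E)
    (hp : p < Module.finrank ℝ E + 2) :
    Tendsto (fun r : ℝ => ∫ y in Metric.ball (0 : E) r, ‖y‖ ^ (2 - p)) (𝓝[>] 0) (𝓝 0) := by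
  have h : Integrable ((Metric.ball (0 : E) 1).indicator fun y => ‖y‖ ^ (2 - p)) :=
    (integrable_indicator_iff Metric.isOpen_ball.measurableSet).2
      (integrableOn_ball_norm_rpow hdim hp 1)
  refine (h.tendsto_setIntegral_nhds_zero (tendsto_volume_ball_zero hdim)).congr' ?_
  have hlt : ∀ᶠ r : ℝ in 𝓝[>] 0, r < 1 := nhdsWithin_le_nhds (Iio_mem_nhds zero_lt_one)
  filter_upwards [hlt] with r hr
  exact setIntegral_congr_fun Metric.isOpen_ball.measurableSet fun y hy =>
    Set.indicator_of_mem (Metric.ball_subset_ball hr.le hy) _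

/-- Upper bound for a principal value integral at a point `t e` near the hyperplane, in terms of
the second differences of `u` near the origin and the mass of `u` far from the hyperplane. -/
theorem principalValue_le (he : ‖e‖ = 1)
    (hR : ∀ y, R y = y - (2 * ⟪e, y⟫) • e) (hodd : ∀ y, u (R y) = -u y)
    (hpos : ∀ y, 0 < ⟪e, y⟫ → 0 < u y) {p r t ρ M ℓ : ℝ} (hp1 : 1 ≤ p)
    (hp : (Module.finrank ℝ E : ℝ) < p) (hp2 : p < Module.finrank ℝ E + 2) (hr : 0 < r)
    (hr2 : r ≤ 1 / 2) (ht : 0 ≤ t) (ht2 : t ≤ 1 / 2) (hM : 0 ≤ M) (htr : t + r < ρ)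
    (hcont : ∀ y, ‖y‖ < ρ → ContinuousAt u y)
    (hdiff : ∀ y, ‖y‖ < ρ → (2 * u (t • e) - u (t • e + y) - u (t • e - y)) -
      (2 * u (-(t • e)) - u (-(t • e) + y) - u (-(t • e) - y)) ≤ 2 * t * M * ‖y‖ ^ 2)
    (hu : IntegrableOn u (Metric.ball ((2 : ℝ) • e) 1))
    (hint : ∀ ε : ℝ, 0 < ε →
      IntegrableOn (fun y => (u (t • e) - u (t • e + y)) * ‖y‖ ^ (-p)) (Metric.ball 0 ε)ᶜ)
    (hlim : Tendsto (fun ε : ℝ => ∫ y in (Metric.ball 0 ε)ᶜ,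
      (u (t • e) - u (t • e + y)) * ‖y‖ ^ (-p)) (𝓝[>] 0) (𝓝 ℓ)) :
    ℓ ≤ t * (M / 2 * ∫ y in Metric.ball (0 : E) r, ‖y‖ ^ (2 - p)) +
      (u (t • e) * (∫ y : E, truncKernel p r y) -
        t * (4 ^ (-p) / 16 * ∫ z in Metric.ball ((2 : ℝ) • e) 1, u z)) := by
  have hp0 : 0 ≤ p := by linarith
  have hdim : 1 ≤ Module.finrank ℝ E := by
    have : Nontrivial E := ⟨e, 0, by rintro rfl; simp at he⟩
    exact Module.finrank_pos
  have hte : ‖t • e‖ = t := by rw [norm_smul, he, mul_one, Real.norm_of_nonneg ht]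
  set D : E → ℝ := fun y => u (t • e) - u (t • e + y) with hD
  have hfar : Integrable fun y => D y * truncKernel p r y := by
    rw [← integrableOn_univ, ← Set.compl_union_self (Metric.ball (0 : E) r)]
    refine IntegrableOn.union ((hint r hr).congr_fun (fun y hy => ?_)
      Metric.isOpen_ball.measurableSet.compl) ?_
    · simp only [Set.mem_compl_iff, Metric.mem_ball, dist_zero_right, not_lt] at hy
      simp only [hD, truncKernel_of_le hy]
    · refine IntegrableOn.mono_set (ContinuousOn.integrableOn_compact
        (isCompact_closedBall (0 : E) r) fun y hy => ?_) Metric.ball_subset_closedBall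
      rw [mem_closedBall_zero_iff] at hy
      have h1 : ContinuousAt u (t • e + y) :=
        hcont _ ((norm_add_le _ _).trans_lt (by linarith))
      have h2 : ContinuousAt (fun y => u (t • e + y)) y :=
        ContinuousAt.comp (f := fun y => t • e + y) h1 (by fun_prop)
      exact ((continuousAt_const.sub h2).mul (continuous_truncKernel hr).continuousAt)
        |>.continuousWithinAt
  have hJ := integrableOn_ball_norm_rpow hdim hp2 r
  -- The bound is uniform in `ε`, so it survives the limit; removing the `ε`-ball keeps the
  -- integrand integrable before symmetrization.
  have hnear : ∀ ε : ℝ, 0 < ε →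
      ∫ y in (Metric.ball 0 ε)ᶜ, D y * (‖y‖ ^ (-p) - truncKernel p r y) ≤
        t * (M / 2 * ∫ y in Metric.ball (0 : E) r, ‖y‖ ^ (2 - p)) := by
    intro ε hε
    set κ : E → ℝ := (Metric.ball (0 : E) ε)ᶜ.indicator
      fun y => ‖y‖ ^ (-p) - truncKernel p r y with hκ
    have hκnorm : ∀ y z : E, ‖y‖ = ‖z‖ → κ y = κ z := fun y z h => by
      simp only [hκ, Set.indicator, Set.mem_compl_iff, Metric.mem_ball, dist_zero_right,
        truncKernel, h]
    have hDκ : (fun y => D y * κ y) = (Metric.ball (0 : E) ε)ᶜ.indicator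
        fun y => D y * (‖y‖ ^ (-p) - truncKernel p r y) := by
      ext y
      simp only [hκ, Set.indicator]
      split_ifs <;> simp
    have hDint : Integrable fun y => D y * κ y := by
      rw [hDκ, integrable_indicator_iff Metric.isOpen_ball.measurableSet.compl]
      refine ((hint ε hε).sub hfar.integrableOn).congr_fun (fun y _ => ?_)
        Metric.isOpen_ball.measurableSet.compl
      simp only [hD, Pi.sub_apply]
      ring
    have hb : Integrable ((Metric.ball (0 : E) r).indicator
        fun y => 2 * t * M * ‖y‖ ^ (2 - p)) := by
      rw [integrable_indicator_iff Metric.isOpen_ball.measurableSet]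
      exact hJ.const_mul _
    have := integral_sub_mul_le_of_secondDiff he hR hodd (fun y => hκnorm _ _ (norm_neg y))
      (fun y => hκnorm _ _ (R.norm_map y)) hDint hb fun y => ?_
    · rw [integral_indicator Metric.isOpen_ball.measurableSet, integral_const_mul] at this
      have h2 : ∫ y, D y * κ y =
          ∫ y in (Metric.ball 0 ε)ᶜ, D y * (‖y‖ ^ (-p) - truncKernel p r y) := by
        rw [hDκ, integral_indicator Metric.isOpen_ball.measurableSet.compl]
      rw [← h2]
      linarith
    · by_cases hy : y ∈ Metric.ball (0 : E) r
      · rw [Set.indicator_of_mem hy]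
        by_cases hy' : y ∈ Metric.ball (0 : E) ε
        · have : κ y = 0 := Set.indicator_of_notMem (Set.notMem_compl_iff.2 hy') _
          rw [this, mul_zero]
          have := Real.rpow_nonneg (norm_nonneg y) (2 - p)
          positivity
        · have h1 : κ y = ‖y‖ ^ (-p) - truncKernel p r y := Set.indicator_of_mem hy' _
          rw [mem_ball_zero_iff] at hy hy'
          have hy0 : 0 < ‖y‖ := by linarith
          have h2 := truncKernel_nonneg (p := p) hr y
          have h3 := truncKernel_le (r := r) hp0 hy0
          have h4 : ‖y‖ ^ (2 - p) = ‖y‖ ^ 2 * ‖y‖ ^ (-p) := by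
            rw [sub_eq_add_neg, Real.rpow_add hy0, Real.rpow_two]
          calc _ ≤ (2 * t * M * ‖y‖ ^ 2) * κ y :=
                mul_le_mul_of_nonneg_right (hdiff y (by linarith)) (by rw [h1]; linarith)
            _ ≤ (2 * t * M * ‖y‖ ^ 2) * ‖y‖ ^ (-p) :=
                mul_le_mul_of_nonneg_left (by rw [h1]; linarith) (by positivity)
            _ = _ := by rw [h4]; ring
      · rw [Set.indicator_of_notMem hy]
        have : κ y = 0 := by
          rw [mem_ball_zero_iff, not_lt] at hy
          simp [hκ, Set.indicator, truncKernel_of_le hy]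
        rw [this, mul_zero]
  -- The truncated part is absolutely integrable, so it needs no principal value.
  have hcompl : Tendsto (fun ε : ℝ => ∫ y in (Metric.ball (0 : E) ε)ᶜ, D y * truncKernel p r y)
      (𝓝[>] 0) (𝓝 (∫ y, D y * truncKernel p r y)) := by
    have hball : Tendsto (fun ε : ℝ => ∫ y in Metric.ball (0 : E) ε, D y * truncKernel p r y)
        (𝓝[>] 0) (𝓝 0) := by
      exact hfar.tendsto_setIntegral_nhds_zero (tendsto_volume_ball_zero hdim)
    have := (tendsto_const_nhds (x := ∫ y, D y * truncKernel p r y)).sub hball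
    rw [sub_zero] at this
    refine this.congr fun ε => ?_
    rw [setIntegral_compl Metric.isOpen_ball.measurableSet hfar]
  refine (le_of_tendsto_of_tendsto hlim (hcompl.const_add
    (t * (M / 2 * ∫ y in Metric.ball (0 : E) r, ‖y‖ ^ (2 - p)))) ?_).trans
    (add_le_add_right (integral_sub_mul_truncKernel_le he hR hodd hpos hp1 hp hr hr2 ht ht2 hu
      hfar) _)
  filter_upwards [eventually_mem_nhdsWithin] with ε hε
  have hsplit : ∫ y in (Metric.ball (0 : E) ε)ᶜ, D y * (‖y‖ ^ (-p) - truncKernel p r y) =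
      (∫ y in (Metric.ball (0 : E) ε)ᶜ, D y * ‖y‖ ^ (-p)) -
        ∫ y in (Metric.ball (0 : E) ε)ᶜ, D y * truncKernel p r y := by
    rw [← integral_sub (hint ε hε) hfar.integrableOn]
    simp only [mul_sub, hD]
  have := hnear ε hε
  simp only [hD] at *
  linarith

end Reflection

/-! ### The Hopf lemma at the origin. -/

section Reflection

variable {E : Type*} [NormedAddCommGroup E] [InnerProductSpace ℝ E] {e : E} {R : E ≃ₗᵢ[ℝ] E}
  {u : E → ℝ}

local notation "⟪" x ", " y "⟫" => inner ℝ x y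

/-- A function that is positive on a half space and odd across its boundary has nonnegative inner
normal derivative at the origin. -/
theorem fderiv_nonneg_of_odd (he : ‖e‖ = 1) (hu : DifferentiableAt ℝ u 0) (hu0 : u 0 = 0)
    (hpos : ∀ y, 0 < ⟪e, y⟫ → 0 < u y) : 0 ≤ fderiv ℝ u 0 e := by
  have c : HasDerivAt (fun s : ℝ => s • e) e 0 := by
    simpa using (hasDerivAt_id (0 : ℝ)).smul_const e
  have hu' : HasFDerivAt u (fderiv ℝ u 0) ((0 : ℝ) • e) := by
    rw [zero_smul]
    exact hu.hasFDerivAt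
  have h := (hasDerivAt_iff_tendsto_slope_zero.1 (hu'.comp_hasDerivAt (0 : ℝ) c)).mono_left
    (nhdsWithin_mono (0 : ℝ) fun t (ht : t ∈ Set.Ioi (0 : ℝ)) => ne_of_gt ht)
  refine ge_of_tendsto h (eventually_mem_nhdsWithin.mono fun t (ht : 0 < t) => ?_)
  have := hpos (t • e) (by
    rw [inner_smul_right, real_inner_self_eq_norm_sq, he]
    linarith)
  simp only [Function.comp, zero_add, zero_smul, hu0, sub_zero, smul_eq_mul]
  positivity

variable [FiniteDimensional ℝ E] [MeasurableSpace E] [BorelSpace E]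

/-- The Hopf lemma at the origin, for a half space with inner unit normal `e` and in terms of
principal value integrals against `‖y‖ ^ (-p)`. -/
theorem fderiv_pos_of_odd_of_principalValue (he : ‖e‖ = 1)
    (hR : ∀ y, R y = y - (2 * ⟪e, y⟫) • e) (hodd : ∀ y, u (R y) = -u y)
    (hpos : ∀ y, 0 < ⟪e, y⟫ → 0 < u y) (hu : ContDiffAt ℝ 3 u 0)
    (hcont : ∀ y, 0 < ⟪e, y⟫ → ContinuousAt u y) {p A : ℝ} (hp1 : 1 ≤ p)
    (hp : (Module.finrank ℝ E : ℝ) < p) (hp2 : p < Module.finrank ℝ E + 2) (hA : 0 < A)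
    {c : ℝ → ℝ} (hc : ∀ ε : ℝ, 0 < ε → ∀ᶠ t in 𝓝[>] 0, c t ≤ ε / t ^ 2)
    (heq : ∀ t : ℝ, 0 < t → ∃ ℓ : ℝ, A * ℓ + c t * u (t • e) = 0 ∧
      (∀ ε : ℝ, 0 < ε →
        IntegrableOn (fun y => (u (t • e) - u (t • e + y)) * ‖y‖ ^ (-p)) (Metric.ball 0 ε)ᶜ) ∧
      Tendsto (fun ε : ℝ => ∫ y in (Metric.ball 0 ε)ᶜ,
        (u (t • e) - u (t • e + y)) * ‖y‖ ^ (-p)) (𝓝[>] 0) (𝓝 ℓ)) :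
    0 < fderiv ℝ u 0 e := by
  have hu0 : u 0 = 0 := by
    have := hodd 0
    rw [map_zero] at this
    linarith
  have hdim : 1 ≤ Module.finrank ℝ E := by
    have : Nontrivial E := ⟨e, 0, by rintro rfl; simp at he⟩
    exact Module.finrank_pos
  refine (fderiv_nonneg_of_odd he (hu.differentiableAt (by simp)) hu0 hpos).lt_of_ne fun hd => ?_
  obtain ⟨ρ, M, hρ, hM, hcont0, hcub, hdiff⟩ := exists_bounds_of_odd_of_fderiv_eq_zero he hu
    (fun t => by rw [← hodd, reflection_smul_self he hR]) hd.symm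
  have hDpos : ∀ z ∈ Metric.closedBall ((2 : ℝ) • e) 1, 0 < ⟪e, z⟫ := fun z hz => by
    rw [Metric.mem_closedBall, dist_eq_norm] at hz
    have h1 : |⟪e, z - (2 : ℝ) • e⟫| ≤ 1 * 1 :=
      (abs_real_inner_le_norm _ _).trans (by rw [he]; gcongr)
    rw [inner_sub_right, inner_smul_right, real_inner_self_eq_norm_sq, he] at h1
    linarith [(abs_le.1 h1).1]
  have huD : IntegrableOn u (Metric.ball ((2 : ℝ) • e) 1) :=
    (ContinuousOn.integrableOn_compact (isCompact_closedBall _ _) fun z hz =>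
      (hcont z (hDpos z hz)).continuousWithinAt).mono_set Metric.ball_subset_closedBall
  have hmass : 0 < ∫ z in Metric.ball ((2 : ℝ) • e) 1, u z := by
    rw [setIntegral_pos_iff_support_of_nonneg_ae]
    · have : Function.support u ∩ Metric.ball ((2 : ℝ) • e) 1 = Metric.ball ((2 : ℝ) • e) 1 :=
        Set.inter_eq_right.2 fun z hz =>
          (hpos z (hDpos z (Metric.ball_subset_closedBall hz))).ne'
      rw [this]
      exact Metric.measure_ball_pos _ _ one_pos
    · exact (ae_restrict_iff' Metric.isOpen_ball.measurableSet).2 (ae_of_all _ fun z hz =>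
        (hpos z (hDpos z (Metric.ball_subset_closedBall hz))).le)
    · exact huD
  set k : ℝ := 4 ^ (-p) / 16 * ∫ z in Metric.ball ((2 : ℝ) • e) 1, u z with hk
  have hk0 : 0 < k := by positivity
  have hJ : Tendsto (fun r : ℝ => M / 2 * ∫ y in Metric.ball (0 : E) r, ‖y‖ ^ (2 - p))
      (𝓝[>] 0) (𝓝 0) := by
    simpa using (tendsto_integral_ball_norm_rpow hdim hp2).const_mul (M / 2)
  have hsmall : ∀ a : ℝ, 0 < a → ∀ᶠ r : ℝ in 𝓝[>] 0, r < a := fun a ha =>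
    nhdsWithin_le_nhds (Iio_mem_nhds ha)
  -- `r` is fixed before `t`: the total mass `S` of the truncated kernel depends on `r`, and only
  -- then is `t` taken small against it.
  obtain ⟨r, ⟨⟨hJr, hrρ⟩, hr2⟩, hr : 0 < r⟩ := (((hJ.eventually (Iio_mem_nhds
    (show 0 < k / 4 by positivity))).and (hsmall (ρ / 2) (by positivity))).and
    (hsmall (1 / 2) (by norm_num))).and eventually_mem_nhdsWithin |>.exists
  set S : ℝ := ∫ y : E, truncKernel p r y with hS
  have hS0 : 0 ≤ S := integral_nonneg fun y => truncKernel_nonneg hr y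
  have hquad : Tendsto (fun t : ℝ => M / 2 * t ^ 2 * S) (𝓝[>] 0) (𝓝 0) := by
    have : Continuous fun t : ℝ => M / 2 * t ^ 2 * S := by fun_prop
    simpa using (this.tendsto 0).mono_left nhdsWithin_le_nhds
  -- `M + 1` replaces `M`, which may be `0`.
  set ε : ℝ := A * (k / 4) / (M + 1) with hε
  have hε0 : 0 < ε := by positivity
  obtain ⟨t, ⟨⟨⟨hct, htρ⟩, ht2⟩, hqt⟩, ht : 0 < t⟩ := ((((hc ε hε0).and
    (hsmall (ρ / 2) (by positivity))).and (hsmall (1 / 2) (by norm_num))).and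
    (hquad.eventually (Iio_mem_nhds (show 0 < k / 4 by positivity)))).and
    eventually_mem_nhdsWithin |>.exists
  replace hJr : M / 2 * ∫ y in Metric.ball (0 : E) r, ‖y‖ ^ (2 - p) < k / 4 := hJr
  replace hqt : M / 2 * t ^ 2 * S < k / 4 := hqt
  obtain ⟨ℓ, hℓ, hint, hlim⟩ := heq t ht
  have hle := principalValue_le he hR hodd hpos hp1 hp hp2 hr hr2.le ht.le ht2.le hM
    (by linarith) hcont0 (fun y hy => hdiff t y ht.le (by linarith) hy) huD hint hlim
  rw [← hk, ← hS] at hle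
  have hut : 0 < u (t • e) := hpos _ (by
    rw [inner_smul_right, real_inner_self_eq_norm_sq, he]
    linarith)
  have hcu := hcub t ht.le (by linarith)
  have h1 : u (t • e) * S ≤ t * (k / 4) := by
    calc u (t • e) * S ≤ (M / 2 * t ^ 3) * S := by gcongr; linarith
      _ = t * (M / 2 * t ^ 2 * S) := by ring
      _ ≤ _ := by gcongr
  have h2 : c t * u (t • e) ≤ t * (A * (k / 4)) := by
    calc c t * u (t • e) ≤ ε / t ^ 2 * u (t • e) := by gcongr
      _ ≤ ε / t ^ 2 * ((M + 1) * t ^ 3) := by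
          gcongr
          have : 0 ≤ t ^ 3 := by positivity
          nlinarith
      _ = t * (A * (k / 4)) := by rw [hε]; field_simp
  -- Of the gain `t k`, the singular part and `u (t • e) * S` use a quarter each; the zero-order
  -- term uses a third quarter (times `A`), leaving a strictly negative sum.
  have h3 : ℓ ≤ -(t * (k / 2)) := by
    have : t * (M / 2 * ∫ y in Metric.ball (0 : E) r, ‖y‖ ^ (2 - p)) ≤ t * (k / 4) := by gcongr
    linarith
  have h4 : A * ℓ ≤ A * -(t * (k / 2)) := by gcongr
  have h5 : 0 < A * (t * k) := by positivity
  linarith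

end Reflection

/-! ### Transfer to the half space in Euclidean space. -/

section EuclideanSpace

variable {n : ℕ} {α : ℝ}

theorem fracLaplacianConst_pos (hα0 : 0 < α) (hα2 : α < 2) : 0 < fracLaplacianConst n α := by
  have h1 : 0 < Real.Gamma ((n + α) / 2) := Real.Gamma_pos_of_pos (by positivity)
  have h2 : 0 < Real.Gamma (1 - α / 2) := Real.Gamma_pos_of_pos (by linarith)
  have := Real.pi_pos
  unfold fracLaplacianConst
  positivity

/-- The truncated integrals of the fractional Laplacian, recentred at the origin. -/
theorem HasFracLaplacianAt.exists_tendsto {w : EuclideanSpace ℝ (Fin n) → ℝ}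
    {x : EuclideanSpace ℝ (Fin n)} {L : ℝ} (hα0 : 0 < α) (hα2 : α < 2)
    (h : HasFracLaplacianAt α w x L) :
    ∃ ℓ : ℝ, L = fracLaplacianConst n α * ℓ ∧
      (∀ ε : ℝ, 0 < ε → IntegrableOn (fun y => (w x - w (x + y)) * ‖y‖ ^ (-((n : ℝ) + α)))
        (Metric.ball 0 ε)ᶜ) ∧
      Tendsto (fun ε : ℝ => ∫ y in (Metric.ball 0 ε)ᶜ,
        (w x - w (x + y)) * ‖y‖ ^ (-((n : ℝ) + α))) (𝓝[>] 0) (𝓝 ℓ) := by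
  have hA := fracLaplacianConst_pos (n := n) hα0 hα2
  have hmp := measurePreserving_add_left (volume : Measure (EuclideanSpace ℝ (Fin n))) x
  have hme := measurableEmbedding_addLeft x
  have hpre : ∀ ε : ℝ, (x + ·) ⁻¹' (Metric.ball x ε)ᶜ = (Metric.ball 0 ε)ᶜ := fun ε => by
    ext y
    simp [dist_eq_norm]
  have hfun : ∀ y, (w x - w (x + y)) / ‖x - (x + y)‖ ^ ((n : ℝ) + α) =
      (w x - w (x + y)) * ‖y‖ ^ (-((n : ℝ) + α)) := fun y => by
    rw [sub_add_cancel_left, norm_neg, Real.rpow_neg (norm_nonneg _), div_eq_mul_inv]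
  refine ⟨L / fracLaplacianConst n α, by field_simp, fun ε hε => ?_, ?_⟩
  · have := (hmp.integrableOn_comp_preimage hme).2 (h.1 ε hε)
    rw [hpre] at this
    simpa only [Function.comp_def, hfun] using this
  · refine (h.2.div_const (fracLaplacianConst n α)).congr fun ε => ?_
    rw [mul_div_cancel_left₀ _ hA.ne', ← hmp.setIntegral_preimage_emb hme, hpre]
    simp only [hfun]

variable [NeZero n] {lam : ℝ}

theorem apply_zero_of_mem_frontier_halfSpace {x : EuclideanSpace ℝ (Fin n)}
    (hx : x ∈ frontier (halfSpace n lam)) : x 0 = lam :=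
  (frontier_lt_subset_eq (f := fun _ => lam) (g := fun x : EuclideanSpace ℝ (Fin n) => x 0)
    continuous_const (by fun_prop) hx : lam = x 0).symm

theorem mem_closure_halfSpace {x : EuclideanSpace ℝ (Fin n)} (hx : lam ≤ x 0) :
    x ∈ closure (halfSpace n lam) := by
  have h : Tendsto (fun t : ℝ => x + t • EuclideanSpace.single (0 : Fin n) (1 : ℝ)) (𝓝[>] 0)
      (𝓝 x) := by
    have : Continuous fun t : ℝ => x + t • EuclideanSpace.single (0 : Fin n) (1 : ℝ) := by fun_prop
    simpa using (this.tendsto 0).mono_left nhdsWithin_le_nhds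
  refine mem_closure_of_tendsto h (eventually_mem_nhdsWithin.mono fun t (ht : 0 < t) => ?_)
  change lam < _
  simp
  linarith

theorem planeReflection_add {x y : EuclideanSpace ℝ (Fin n)} (hx : x 0 = lam) :
    planeReflection lam (x + y) = x + (y - (2 * y 0) • EuclideanSpace.single 0 1) := by
  ext i
  by_cases hi : i = 0
  · subst hi
    simp [planeReflection, hx]
    ring
  · simp [planeReflection, hi]

/-- Antisymmetry in the half space propagates to the whole space. -/
theorem planeReflection_eq_neg {w : EuclideanSpace ℝ (Fin n) → ℝ}
    (hcont : ∀ x ∈ closure (halfSpace n lam), ContinuousAt w x)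
    (hanti : ∀ x ∈ halfSpace n lam, w (planeReflection lam x) = -w x)
    (x : EuclideanSpace ℝ (Fin n)) : w (planeReflection lam x) = -w x := by
  have hinv : planeReflection lam (planeReflection lam x) = x := by
    ext i
    by_cases hi : i = 0
    · subst hi
      simp [planeReflection]
    · simp [planeReflection]
  rcases lt_trichotomy (x 0) lam with h | h | h
  · have := hanti (planeReflection lam x) (by
      change lam < _
      simp only [planeReflection, Function.update_self]
      linarith)
    rw [hinv] at this
    linarith
  · have hfix : planeReflection lam x = x := by
      have := planeReflection_add (y := 0) h
      simpa using this
    have hw := hcont x (mem_closure_halfSpace h.ge)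
    set e : EuclideanSpace ℝ (Fin n) := EuclideanSpace.single 0 1 with he
    have hadd : ∀ s : ℝ, Tendsto (fun t : ℝ => w (x + (s * t) • e)) (𝓝[>] 0) (𝓝 (w x)) := by
      intro s
      have h1 : Continuous fun t : ℝ => x + (s * t) • e := by fun_prop
      have h2 : Tendsto (fun t : ℝ => x + (s * t) • e) (𝓝[>] 0) (𝓝 x) := by
        simpa using (h1.tendsto 0).mono_left nhdsWithin_le_nhds
      exact hw.tendsto.comp h2
    -- On the plane itself, oddness comes from approaching `x` from both sides along `e`.
    have hlim : w x = -w x := by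
      refine tendsto_nhds_unique (hadd (-1)) ((hadd 1).neg.congr' ?_)
      refine eventually_mem_nhdsWithin.mono fun t (ht : 0 < t) => ?_
      change -w (x + (1 * t) • e) = w (x + (-1 * t) • e)
      rw [← hanti _ (by simp [halfSpace, h, he, ht]), planeReflection_add h]
      congr 2
      simp only [he, PiLp.smul_apply, PiLp.single_apply, if_true, smul_eq_mul]
      module
    rw [hfix, ← hlim]
  · exact hanti x h

theorem le_infDist_frontier_halfSpace {x z : EuclideanSpace ℝ (Fin n)}
    (hx : x ∈ frontier (halfSpace n lam)) :
    z 0 - lam ≤ Metric.infDist z (frontier (halfSpace n lam)) := by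
  refine (Metric.le_infDist ⟨x, hx⟩).2 fun y hy => ?_
  rw [← apply_zero_of_mem_frontier_halfSpace hy, dist_eq_norm]
  exact (le_abs_self _).trans (PiLp.norm_apply_le (z - y) 0)

end EuclideanSpace

/-- Since the distance is positive on the half space, `hc` is the limsup condition cleared of its
product. With `p = n + α`, the range `0 < α < 2` is exactly `n < p < n + 2`. -/
theorem mainTheorem1 (n : ℕ) [NeZero n] (α : ℝ) (hα0 : 0 < α) (hα2 : α < 2) (lam : ℝ)
    (w c : EuclideanSpace ℝ (Fin n) → ℝ)
    (hw_smooth : ∀ x ∈ closure (halfSpace n lam), ContDiffAt ℝ 3 w x)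
    (hc : ∀ x₀ ∈ frontier (halfSpace n lam), ∀ ε : ℝ, 0 < ε →
      ∀ᶠ x in 𝓝[halfSpace n lam] x₀,
        c x ≤ ε / Metric.infDist x (frontier (halfSpace n lam)) ^ 2)
    (hw_eq : ∀ x ∈ halfSpace n lam,
      ∃ L : ℝ, HasFracLaplacianAt α w x L ∧ L + c x * w x = 0)
    (hw_pos : ∀ x ∈ halfSpace n lam, 0 < w x)
    (hw_anti : ∀ x ∈ halfSpace n lam, w (planeReflection lam x) = -w x) :
    ∀ x ∈ frontier (halfSpace n lam), lineDeriv ℝ w x (outwardNormal n) < 0 := by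
  intro x hx
  have hx0 := apply_zero_of_mem_frontier_halfSpace hx
  set e : EuclideanSpace ℝ (Fin n) := EuclideanSpace.single 0 1 with he
  have he1 : ‖e‖ = 1 := by simp [he]
  have hinner : ∀ y, inner ℝ e y = y 0 := fun y => by
    simp [he, EuclideanSpace.inner_single_left]
  have hR : ∀ y, (ℝ ∙ e)ᗮ.reflection y = y - (2 * inner ℝ e y) • e := fun y => by
    rw [Submodule.reflection_orthogonal_apply, Submodule.reflection_singleton_apply, he1]
    simp only [RCLike.ofReal_real_eq_id, id_eq, one_pow, div_one]
    module
  have hmem : ∀ y, 0 < inner ℝ e y → x + y ∈ halfSpace n lam := fun y hy => by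
    rw [hinner] at hy
    simpa [halfSpace, hx0] using hy
  have hte : ∀ t : ℝ, inner ℝ e (t • e) = t := fun t => by
    rw [inner_smul_right, real_inner_self_eq_norm_sq, he1]
    ring
  have hadd : ∀ y, ContDiffAt ℝ 3 (fun y => x + y) y := fun y => by fun_prop
  have hsm : ∀ y, 0 ≤ inner ℝ e y → ContDiffAt ℝ 3 (fun y => w (x + y)) y := fun y hy =>
    (hw_smooth (x + y) (mem_closure_halfSpace (by
      rw [hinner] at hy
      simpa [hx0] using hy))).comp y (hadd y)
  have hdim : Module.finrank ℝ (EuclideanSpace ℝ (Fin n)) = n := finrank_euclideanSpace_fin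
  have hn : (1 : ℝ) ≤ n := by exact_mod_cast NeZero.one_le
  have key : 0 < fderiv ℝ (fun y => w (x + y)) 0 e := by
    refine fderiv_pos_of_odd_of_principalValue (R := (ℝ ∙ e)ᗮ.reflection) (p := n + α) he1 hR
      (fun y => ?_) (fun y hy => hw_pos _ (hmem y hy)) (hsm 0 (by simp))
      (fun y hy => (hsm y hy.le).continuousAt) (by linarith) (by rw [hdim]; linarith)
      (by rw [hdim]; linarith) (fracLaplacianConst_pos (n := n) hα0 hα2)
      (c := fun t => c (x + t • e)) (fun ε hε => ?_) (fun t ht => ?_)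
    · rw [← planeReflection_eq_neg (fun z hz => (hw_smooth z hz).continuousAt) hw_anti,
        planeReflection_add hx0, hR, hinner]
    · have h1 : Tendsto (fun t : ℝ => x + t • e) (𝓝[>] 0) (𝓝[halfSpace n lam] x) := by
        refine tendsto_nhdsWithin_iff.2 ⟨?_, eventually_mem_nhdsWithin.mono
          fun t (ht : 0 < t) => hmem _ (by rwa [hte])⟩
        have : Continuous fun t : ℝ => x + t • e := by fun_prop
        simpa using (this.tendsto 0).mono_left nhdsWithin_le_nhds
      filter_upwards [h1.eventually (hc x hx ε hε), eventually_mem_nhdsWithin] with t ht ht0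
      have ht0 : 0 < t := ht0
      -- Only `t ≤ infDist` is needed, since the upper bound for `c` decreases with the distance.
      have h2 := le_infDist_frontier_halfSpace (z := x + t • e) hx
      have h3 : (x + t • e) 0 - lam = t := by simp [hx0, he]
      rw [h3] at h2
      exact ht.trans (by gcongr)
    · obtain ⟨L, hL, hL0⟩ := hw_eq (x + t • e) (hmem _ (by rwa [hte]))
      obtain ⟨ℓ, hℓ, hint, hlim⟩ := hL.exists_tendsto hα0 hα2
      refine ⟨ℓ, by rw [← hℓ]; exact hL0, ?_⟩
      simp only [← add_assoc]
      exact ⟨hint, hlim⟩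
  rw [fderiv_comp_add_left, add_zero] at key
  have hwd : DifferentiableAt ℝ w x :=
    (hw_smooth x (mem_closure_halfSpace hx0.ge)).differentiableAt (by simp)
  rw [hwd.lineDeriv_eq_fderiv, outwardNormal, map_neg]
  linarith
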